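/- Let $R$ be a semi-local Noetherian integral domain (that is, a Noetherian domain with finitely many maximal ideals) such that for every maximal ideal $\mathfrak m$ the residue field $R/\mathfrak m$ is infinite and of characteristic different from $2$; in particular $2$ is invertible in $R$. Let $S$ be a commutative finite étale $R$-algebra (not necessarily a domain), and let $(V,q)$ be a quadratic space over $R$, i.e. $V$ is a finitely generated projective $R$-module and $q\colon V\to R$ is a quadratic form whose associated symmetric bilinear form $(x,y)\mapsto q(x+y)-q(x)-q(y)$ induces an isomorphism $V\to \operatorname{Hom}_R(V,R)$. Let $(V_S,q_S)=(S\otimes_R V,\ S\otimes_R q)$ be its base change to $S$. Let $D_q(R)\subset R^*$ be the subgroup generated by the units of $R$ of the form $q(v)$ with $v\in V$, and let $D_q(S)\subset S^*$ be the subgroup generated by the units of $S$ of the form $q_S(v)$ with $v\in V_S$. Then $$N^S_R(D_q(S))\subset D_q(R),$$ where $N^S_R\colon S^*\to R^*$ is the norm map, $N^S_R(s)$ being the determinant of the $R$-linear map $x\mapsto sx$ on the free $R$-module $S$. -/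

import Mathlib

/-- If no residue field of `R` has characteristic `2`, then `2` is a unit of `R`. -/
theorem isUnit_two_of_residue {R : Type*} [CommRing R]
    (h : ∀ m : Ideal R, m.IsMaximal → ringChar (R ⧸ m) ≠ 2) : IsUnit (2 : R) := by
  by_contra h2
  obtain ⟨m, hm, h2m⟩ := exists_max_ideal_of_mem_nonunits h2
  have : Nontrivial (R ⧸ m) := Ideal.Quotient.nontrivial_iff.mpr hm.ne_top
  have h0 : ((2 : ℕ) : R ⧸ m) = 0 := by
    have h3 := Ideal.Quotient.eq_zero_iff_mem.mpr h2m
    rw [← h3, ← map_natCast (Ideal.Quotient.mk m), Nat.cast_ofNat]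
  have hd : ringChar (R ⧸ m) ∣ 2 := ringChar.dvd h0
  rcases (Nat.dvd_prime Nat.prime_two).mp hd with h1 | h1
  · exact CharP.ringChar_ne_one h1
  · exact h m hm h1

/-- The inverse of `2` in a ring none of whose residue fields has characteristic `2`. -/
@[reducible] noncomputable def invertibleTwoOfResidue {R : Type*} [CommRing R]
    (h : ∀ m : Ideal R, m.IsMaximal → ringChar (R ⧸ m) ≠ 2) : Invertible (2 : R) :=
  (isUnit_two_of_residue h).invertible

/-- `(V, q)` is a quadratic space over `R`: the module `V` is finitely generated projective and the
symmetric bilinear form `q (x + y) - q x - q y` induces an isomorphism from `V` to its dual. -/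
structure IsQuadraticSpace {R V : Type*} [CommRing R] [AddCommGroup V] [Module R V]
    (q : QuadraticForm R V) : Prop where
  finite : Module.Finite R V
  projective : Module.Projective R V
  nonsingular : Function.Bijective q.polarBilin

/-- The subgroup of `Rˣ` generated by the units of `R` that are represented by `q`. -/
def representedUnits {R V : Type*} [CommRing R] [AddCommGroup V] [Module R V]
    (q : QuadraticForm R V) : Subgroup Rˣ :=
  Subgroup.closure {u : Rˣ | ∃ v : V, q v = (u : R)}

open Polynomial

/-! Infinite residue fields give a primitive element, so `S = R[X]/p`, and the norm of the class of
`g` is the resultant of `p` and `g` (`PowerBasis.norm_aeval_gen`). A value of `q_S` is the class of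
`Q(y)`, with `Q` a quadratic form over `R` and `y` a vector of polynomials. It remains to show that
`Res(p, Q(y))` is a product of unit values of `Q` and inverses of such, whenever `Q(y)` is coprime
to `p`.

This goes by strong induction on `n = deg p` (`resultant_matrixForm_mem_formUnits`). Squares of
units are harmless, so `y` may be multiplied by some `c` prime to `p` and reduced to `x` of degree
at most `n - 1`, with `Q(x)` congruent to `β b` modulo `p`, `b` monic of degree `n - 1`. A suitable
`z` congruent to `e x` modulo `p` has `F = Q(z) = e² β b + p η h` with `deg h = n - 2`. As `F` is `p
η h` modulo `b` and `e² β b` modulo `h`, reciprocity of resultants expresses `Res(p, β b)` through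
`Res(b, F)` and `Res(h, F)`, up to squares and a power of `η` (`resultant_reduction`). Both are
covered by induction once the coprimality conditions hold. These are arranged over each residue
field by avoiding finitely many parameters, then lifted by the Chinese remainder theorem. -/

/-! ### Quadratic forms given by a matrix -/

/-- The value at `x` of the quadratic form with coefficient matrix `M`. -/
def matrixForm {A : Type*} [CommRing A] {r : ℕ} (M : Matrix (Fin r) (Fin r) A) (x : Fin r → A) : A :=
  ∑ i, ∑ j, M i j * x i * x j

section matrixForm

variable {A B : Type*} [CommRing A] [CommRing B] {r : ℕ} (M : Matrix (Fin r) (Fin r) A)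

theorem map_matrixForm (f : A →+* B) (x : Fin r → A) :
    f (matrixForm M x) = matrixForm (M.map f) (fun i => f (x i)) := by
  simp [matrixForm, map_sum]

theorem matrixForm_mul (c : A) (x : Fin r → A) :
    matrixForm M (fun i => c * x i) = c ^ 2 * matrixForm M x := by
  simp only [matrixForm, Finset.mul_sum]
  refine Finset.sum_congr rfl fun i _ => Finset.sum_congr rfl fun j _ => by ring

/-- The polar form of `matrixForm M`. -/
def matrixPolar (x y : Fin r → A) : A := ∑ i, ∑ j, M i j * (x i * y j + y i * x j)

theorem matrixForm_add_mul (x y : Fin r → A) (a : A) :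
    matrixForm M (fun i => x i + a * y i) =
      matrixForm M x + a * matrixPolar M x y + a ^ 2 * matrixForm M y := by
  simp only [matrixForm, matrixPolar, Finset.mul_sum, ← Finset.sum_add_distrib]
  refine Finset.sum_congr rfl fun i _ => Finset.sum_congr rfl fun j _ => by ring

theorem dvd_matrixForm_sub {p : A} {x y : Fin r → A} (h : ∀ i, p ∣ x i - y i) :
    p ∣ matrixForm M x - matrixForm M y := by
  simp only [matrixForm, ← Finset.sum_sub_distrib]
  refine Finset.dvd_sum fun i _ => Finset.dvd_sum fun j _ => ?_
  have : M i j * x i * x j - M i j * y i * y j =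
    M i j * x j * (x i - y i) + M i j * y i * (x j - y j) := by ring
  rw [this]
  exact dvd_add (Dvd.dvd.mul_left (h i) _) (Dvd.dvd.mul_left (h j) _)

theorem eval_matrixForm_map_C (x : Fin r → A[X]) (a : A) :
    (matrixForm (M.map C) x).eval a = matrixForm M (fun i => (x i).eval a) := by
  have := map_matrixForm (M.map C) (evalRingHom a) x
  simp only [coe_evalRingHom] at this
  rw [this]
  congr 1
  ext i j
  simp

theorem map_matrixForm_map_C (f : A →+* B) (x : Fin r → A[X]) :
    (matrixForm (M.map C) x).map f = matrixForm ((M.map f).map C) (fun i => (x i).map f) := by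
  have := map_matrixForm (M.map C) (mapRingHom f) x
  simp only [coe_mapRingHom] at this
  rw [this]
  congr 1
  ext i j
  simp

theorem natDegree_matrixForm_le {x : Fin r → A[X]} {d : ℕ} (h : ∀ i, (x i).natDegree ≤ d) :
    (matrixForm (M.map C) x).natDegree ≤ d + d := by
  refine natDegree_sum_le_of_forall_le _ _ fun i _ =>
    natDegree_sum_le_of_forall_le _ _ fun j _ => ?_
  rw [mul_assoc]
  exact (natDegree_C_mul_le _ _).trans (natDegree_mul_le_of_le (h i) (h j))

theorem coeff_matrixForm {x : Fin r → A[X]} {d : ℕ} (h : ∀ i, (x i).natDegree ≤ d) :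
    (matrixForm (M.map C) x).coeff (d + d) = matrixForm M (fun i => (x i).coeff d) := by
  simp only [matrixForm, finsetSum_coeff, Matrix.map_apply, mul_assoc, coeff_C_mul]
  refine Finset.sum_congr rfl fun i _ => Finset.sum_congr rfl fun j _ => ?_
  rw [coeff_mul_add_eq_of_natDegree_le (h i) (h j)]

/-- The units of `A` that are products of unit values of `matrixForm M` and their inverses, as
elements of `A`. -/
def formUnits : Submonoid A :=
  (Subgroup.closure {u : Aˣ | ∃ x, matrixForm M x = (u : A)}).toSubmonoid.map (Units.coeHom A)

variable {M}

theorem matrixForm_mem_formUnits {x : Fin r → A} (h : IsUnit (matrixForm M x)) :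
    matrixForm M x ∈ formUnits M :=
  ⟨h.unit, Subgroup.subset_closure ⟨x, rfl⟩, rfl⟩

theorem mem_formUnits_of_mul_mem {a b : A} (hb : b ∈ formUnits M) (h : a * b ∈ formUnits M) :
    a ∈ formUnits M := by
  obtain ⟨u, hu, rfl⟩ := hb
  obtain ⟨w, hw, hwu⟩ := h
  refine ⟨w * u⁻¹, Subgroup.mul_mem _ hw (Subgroup.inv_mem _ hu), ?_⟩
  simp only [Units.coeHom_apply] at hwu ⊢
  rw [Units.val_mul, hwu, Units.mul_inv_cancel_right]

/-- `c²` is the quotient of the unit values at `c x` and at `x`. -/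
theorem sq_mem_formUnits {x : Fin r → A} (h : IsUnit (matrixForm M x)) {c : A} (hc : IsUnit c) :
    c ^ 2 ∈ formUnits M := by
  refine mem_formUnits_of_mul_mem (matrixForm_mem_formUnits h) ?_
  rw [← matrixForm_mul]
  exact matrixForm_mem_formUnits (by rw [matrixForm_mul]; exact (hc.pow 2).mul h)

end matrixForm

/-! ### Resultants with a monic polynomial -/

namespace Polynomial

variable {A B : Type*} [CommRing A] [CommRing B] {p : A[X]}

/-- Raising the formal degree of `g` multiplies the resultant by a power of the leading coefficient
of `p`, which is 1. Hence `Res(p, ·)` behaves like the norm from `A[X]/p`: multiplicative and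
dependent only on the class modulo `p`. -/
theorem Monic.resultant_natDegree_eq (hp : p.Monic) {g : A[X]} {k : ℕ} (hk : g.natDegree ≤ k) :
    resultant p g p.natDegree k = resultant p g := by
  obtain ⟨d, rfl⟩ := Nat.exists_eq_add_of_le hk
  rw [resultant_add_right_deg _ _ _ _ _ le_rfl]
  simp [hp.coeff_natDegree]

theorem Monic.resultant_mul (hp : p.Monic) (f g : A[X]) :
    resultant p (f * g) = resultant p f * resultant p g := by
  rw [← resultant_mul_right _ _ _ _ le_rfl, hp.resultant_natDegree_eq natDegree_mul_le]

theorem Monic.resultant_C_mul (hp : p.Monic) (a : A) (g : A[X]) :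
    resultant p (C a * g) = a ^ p.natDegree * resultant p g := by
  rw [hp.resultant_mul, ← hp.resultant_natDegree_eq (natDegree_C a).le, resultant_C_zero_right]

theorem Monic.resultant_add_mul (hp : p.Monic) (g f : A[X]) :
    resultant p (g + p * f) = resultant p g := by
  set k := max (max g.natDegree (p * f).natDegree) (f.natDegree + p.natDegree)
  rw [← hp.resultant_natDegree_eq (k := k), ← hp.resultant_natDegree_eq (g := g) (k := k),
    resultant_add_mul_right _ _ _ _ _ (le_max_right _ _) le_rfl]
  · exact (le_max_left _ _).trans (le_max_left _ _)
  · exact (natDegree_add_le _ _).trans (le_max_left _ _)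

theorem Monic.resultant_eq_of_dvd_sub (hp : p.Monic) {f g : A[X]} (h : p ∣ f - g) :
    resultant p f = resultant p g := by
  obtain ⟨q, hq⟩ := h
  rw [← hp.resultant_add_mul g q, ← hq, add_sub_cancel]

theorem Monic.resultant_mul_left [Nontrivial A] (hp : p.Monic) {q : A[X]} (hq : q.Monic) (g : A[X]) :
    resultant (p * q) g = resultant p g * resultant q g := by
  rw [hp.natDegree_mul hq, Polynomial.resultant_mul_left _ _ _ _ le_rfl]

theorem isCoprime_of_dvd_sub {f g : A[X]} (h : p ∣ f - g) (hf : IsCoprime p f) : IsCoprime p g := by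
  obtain ⟨q, hq⟩ := h
  have : g = f + p * (-q) := by rw [mul_neg, ← hq]; ring
  rw [this]
  exact IsCoprime.add_mul_left_right hf _

theorem isCoprime_X_sub_C_iff {a : A} {f : A[X]} :
    IsCoprime (X - C a) f ↔ IsUnit (f.eval a) := by
  rw [← isUnit_resultant_iff_isCoprime (monic_X_sub_C a)]
  nontriviality A
  rw [natDegree_X_sub_C, resultant_X_sub_C_left _ _ _ le_rfl]

theorem isCoprime_C_mul_right {a : A} (ha : IsUnit a) {f g : A[X]} :
    IsCoprime f (C a * g) ↔ IsCoprime f g :=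
  isCoprime_mul_unit_left_right (ha.map C) f g

/-- The inductive step of the norm principle, for polynomials in good position: if
`F = e² (β b) + p (η h)`, the norm of `β b` modulo `p` is determined by the norms of `F`
modulo `b` and modulo `h`. -/
theorem resultant_reduction [Nontrivial A] {b h e F : A[X]} {β η : A} {k : ℕ} (hp : p.Monic)
    (hb : b.Monic) (hh : h.Monic) (hpn : p.natDegree = k + 2) (hbn : b.natDegree = k + 1)
    (hhn : h.natDegree = k) (hF : F = e ^ 2 * (C β * b) + p * (C η * h)) :
    resultant p (C β * b) * η ^ (k + 1) * resultant h F =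
      (β ^ (k + 1) * resultant h e) ^ 2 * resultant b F := by
  -- Modulo `b`, `F` is `η p h`. Swapping the arguments costs no sign, since `deg (p h) = 2k + 2` is
  -- even.
  have h1 : resultant b F = η ^ (k + 1) * (resultant p b * resultant h b) := by
    have : resultant b F = resultant b (C η * (p * h)) := by
      refine hb.resultant_eq_of_dvd_sub ⟨e ^ 2 * C β, ?_⟩
      rw [hF]
      ring
    rw [this, hb.resultant_C_mul, ← hp.resultant_mul_left hh, resultant_comm,
      hp.natDegree_mul hh, hpn, hhn, hbn, Even.neg_one_pow, one_mul]
    exact ⟨(k + 1) * (k + 1), by ring⟩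
  have h2 : resultant h F = resultant h e ^ 2 * (β ^ k * resultant h b) := by
    have : resultant h F = resultant h (e ^ 2 * (C β * b)) := by
      refine hh.resultant_eq_of_dvd_sub ⟨p * C η, ?_⟩
      rw [hF]
      ring
    rw [this, hh.resultant_mul, hh.resultant_C_mul, sq, hh.resultant_mul, hhn]
    ring
  rw [h1, h2, hp.resultant_C_mul, hpn]
  ring

end Polynomial

/-! ### General position over an infinite field -/

theorem finite_setOf_quadratic_eq_zero {k : Type*} [Field k] {u v w a₀ : k}
    (h : u + a₀ * v + a₀ ^ 2 * w ≠ 0) : {a : k | u + a * v + a ^ 2 * w = 0}.Finite := by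
  classical
  let f : k[X] := C u + X * C v + X ^ 2 * C w
  have hev : ∀ a, f.eval a = u + a * v + a ^ 2 * w := fun a => by simp [f]; ring
  have hf : f ≠ 0 := fun h0 => h (by rw [← hev, h0, eval_zero])
  refine (f.roots.toFinset.finite_toSet).subset fun a ha => ?_
  rw [Finset.mem_coe, Multiset.mem_toFinset, mem_roots hf, IsRoot, hev]
  exact ha

theorem finite_setOf_quadratic_eq_zero_of_ne {k : Type*} [Field k] {u v w : k}
    (h : w ≠ 0) : {a : k | u + a * v + a ^ 2 * w = 0}.Finite := by
  classical
  let f : k[X] := C u + X * C v + X ^ 2 * C w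
  have hev : ∀ a, f.eval a = u + a * v + a ^ 2 * w := fun a => by simp [f]; ring
  have hf : f ≠ 0 := fun h0 => h (by simpa [f, coeff_X, coeff_C] using congrArg (coeff · 2) h0)
  refine (f.roots.toFinset.finite_toSet).subset fun a ha => ?_
  rw [Finset.mem_coe, Multiset.mem_toFinset, mem_roots hf, IsRoot, hev]
  exact ha

/-- Failure of coprimality is a common root in the algebraic closure. Each of the finitely many
roots of `g` excludes the zeros of one quadratic in `a`, whose nonvanishing may be witnessed by `a₀`
outside `k`. -/
theorem finite_setOf_not_isCoprime {k : Type*} [Field k] {g F₀ F₁ F₂ : k[X]} (hg : g ≠ 0)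
    (h : ∀ β : AlgebraicClosure k, aeval β g = 0 →
      ∃ a₀, aeval β F₀ + a₀ * aeval β F₁ + a₀ ^ 2 * aeval β F₂ ≠ 0) :
    {a : k | ¬ IsCoprime g (F₀ + C a * F₁ + C a ^ 2 * F₂)}.Finite := by
  classical
  have hfin : (⋃ β ∈ (g.aroots (AlgebraicClosure k)).toFinset,
      algebraMap k (AlgebraicClosure k) ⁻¹'
        {a | aeval β F₀ + a * aeval β F₁ + a ^ 2 * aeval β F₂ = 0}).Finite := by
    refine Set.Finite.biUnion (Finset.finite_toSet _) fun β hβ => ?_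
    refine Set.Finite.preimage (algebraMap k (AlgebraicClosure k)).injective.injOn ?_
    have hβ' : aeval β g = 0 := by
      have := (Multiset.mem_toFinset.mp hβ)
      rw [mem_aroots] at this
      exact this.2
    obtain ⟨a₀, ha₀⟩ := h β hβ'
    exact finite_setOf_quadratic_eq_zero ha₀
  refine hfin.subset fun a ha => ?_
  simp only [Set.mem_ofPred_eq, isCoprime_iff_aeval_ne_zero_of_isAlgClosed k (AlgebraicClosure k),
    not_forall, not_or, not_not] at ha
  obtain ⟨β, h1, h2⟩ := ha
  simp only [Set.mem_iUnion]
  refine ⟨β, by rw [Multiset.mem_toFinset, mem_aroots]; exact ⟨hg, h1⟩, ?_⟩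
  simpa using h2

/-- The coefficient of degree `m` of the remainder modulo `p`. -/
noncomputable def modCoeff {A : Type*} [CommRing A] (p : A[X]) (m : ℕ) : A[X] →ₗ[A] A :=
  lcoeff A m ∘ₗ modByMonicHom p

theorem modCoeff_apply {A : Type*} [CommRing A] (p : A[X]) (m : ℕ) (f : A[X]) :
    modCoeff p m f = (f %ₘ p).coeff m := rfl

theorem modCoeff_C_mul {A : Type*} [CommRing A] (p : A[X]) (m : ℕ) (a : A) (f : A[X]) :
    modCoeff p m (C a * f) = a * modCoeff p m f := by
  rw [← smul_eq_C_mul, map_smul, smul_eq_mul]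

theorem modCoeff_congr {A : Type*} [CommRing A] {p f g : A[X]} (hp : p.Monic) (m : ℕ)
    (h : p ∣ f - g) : modCoeff p m f = modCoeff p m g := by
  rw [modCoeff_apply, modCoeff_apply, modByMonic_eq_of_dvd_sub hp h]

/-- Nondegeneracy of the pairing `(d, z) ↦ modCoeff p m (d * z)` on `k[X]/p`: a power of `X` shifts
the nonzero remainder of `z` to degree exactly `m`. -/
theorem exists_modCoeff_mul_ne_zero {k : Type*} [Field k] {p z : k[X]} {m : ℕ} (hp : p.Monic)
    (hm : p.natDegree = m + 1) (hz : ¬ p ∣ z) : ∃ d, modCoeff p m (d * z) ≠ 0 := by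
  obtain ⟨w, hwz⟩ : ∃ w, w = z %ₘ p := ⟨_, rfl⟩
  have hw : w ≠ 0 := fun h => hz ((modByMonic_eq_zero_iff_dvd hp).mp (hwz ▸ h))
  have hdeg : w.natDegree ≤ m := by
    have := natDegree_modByMonic_lt z hp (by rintro rfl; simp at hm)
    rw [← hwz] at this
    omega
  refine ⟨X ^ (m - w.natDegree), ?_⟩
  have h1 : modCoeff p m (X ^ (m - w.natDegree) * z) = modCoeff p m (X ^ (m - w.natDegree) * w) := by
    refine modCoeff_congr hp m ?_
    rw [← mul_sub]
    exact Dvd.dvd.mul_left (by rw [dvd_sub_comm, hwz]; exact dvd_modByMonic_sub z p) _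
  have h2 : (X ^ (m - w.natDegree) * w).natDegree = m := by
    rw [natDegree_X_pow_mul _ hw]; omega
  rw [h1, modCoeff_apply, (modByMonic_eq_self_iff hp).mpr]
  · have h3 := coeff_natDegree (p := X ^ (m - w.natDegree) * w)
    rw [h2] at h3
    rw [h3, leadingCoeff_ne_zero]
    exact mul_ne_zero (pow_ne_zero _ X_ne_zero) hw
  · exact degree_lt_degree (by omega)

/-- Polarization: vanishing at `1`, `d` and `1 + d` would kill `2 * modCoeff p m (d * b)`, against
nondegeneracy of the pairing. -/
theorem exists_modCoeff_sq_mul_ne_zero {k : Type*} [Field k] (h2 : (2 : k) ≠ 0) {p b : k[X]} {m : ℕ}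
    (hp : p.Monic) (hm : p.natDegree = m + 1) (hb : ¬ p ∣ b) :
    ∃ c, modCoeff p m (c ^ 2 * b) ≠ 0 := by
  by_contra! h
  obtain ⟨d, hd⟩ := exists_modCoeff_mul_ne_zero hp hm hb
  have e : (1 + d) ^ 2 * b = 1 ^ 2 * b + d ^ 2 * b + C 2 * (d * b) := by
    rw [map_ofNat]; ring
  have := h (1 + d)
  rw [e, map_add, map_add, h, h, modCoeff_C_mul, zero_add, zero_add] at this
  exact (mul_ne_zero h2 hd) this

/-- The combination `∑ φ i * y i` pairs to zero with every `d`, so `p` divides it, and its degree is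
too small for it to be nonzero. -/
theorem coeff_combination_eq_zero {k : Type*} [Field k] {p : k[X]} {m r : ℕ} (hp : p.Monic)
    (hm : p.natDegree = m + 1) {y : Fin r → k[X]} (hy : ∀ i, (y i).natDegree ≤ m) {φ : Fin r → k}
    (h : ∀ d, ∑ i, φ i * modCoeff p m (d * y i) = 0) (s : ℕ) : ∑ i, φ i * (y i).coeff s = 0 := by
  have hz : ∑ i, C (φ i) * y i = 0 := by
    by_contra hne
    have hdeg : (∑ i, C (φ i) * y i).natDegree ≤ m :=
      natDegree_sum_le_of_forall_le _ _ fun i _ => (natDegree_C_mul_le _ _).trans (hy i)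
    obtain ⟨d, hd⟩ := exists_modCoeff_mul_ne_zero (z := ∑ i, C (φ i) * y i) hp hm fun hdvd => by
      have := natDegree_le_of_dvd hdvd hne
      omega
    refine hd ?_
    rw [Finset.mul_sum, map_sum, ← h d]
    refine Finset.sum_congr rfl fun i _ => ?_
    rw [← modCoeff_C_mul]
    congr 1
    ring
  simpa [finsetSum_coeff] using congrArg (coeff · s) hz

/-- If the form vanished for all `d`, so would its polar form on all pairs `d`, `e`. Nondegeneracy
of the pairing, applied to one argument and then the other, makes the polar form vanish on all
coefficient vectors of `y`, whence `2 Q(y) = 0`. -/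
theorem exists_matrixForm_modCoeff_ne_zero {k : Type*} [Field k] (h2 : (2 : k) ≠ 0) {p : k[X]}
    {m r : ℕ} (hp : p.Monic) (hm : p.natDegree = m + 1) (M : Matrix (Fin r) (Fin r) k)
    {y : Fin r → k[X]} (hy : ¬ p ∣ matrixForm (M.map C) y) :
    ∃ d, matrixForm M (fun i => modCoeff p m (d * y i)) ≠ 0 := by
  wlog hdeg : ∀ i, (y i).natDegree ≤ m generalizing y
  · have hdvd : ∀ i, p ∣ y i %ₘ p - y i := fun i => dvd_modByMonic_sub _ _
    obtain ⟨d, hd⟩ := this (y := fun i => y i %ₘ p)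
      (fun h => hy ((dvd_sub_right h).mp (dvd_matrixForm_sub (M.map C) hdvd)))
      (fun i => by
        have := natDegree_modByMonic_lt (y i) hp (by rintro rfl; simp at hm)
        omega)
    refine ⟨d, ?_⟩
    convert hd using 3 with i
    refine modCoeff_congr hp m ?_
    rw [← mul_sub]
    exact Dvd.dvd.mul_left (by rw [dvd_sub_comm]; exact hdvd i) _
  by_contra! h
  have hpol : ∀ d e, matrixPolar M (fun i => modCoeff p m (d * y i))
      (fun i => modCoeff p m (e * y i)) = 0 := fun d e => by
    have := matrixForm_add_mul M (fun i => modCoeff p m (d * y i))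
      (fun i => modCoeff p m (e * y i)) 1
    simp only [one_mul, h, one_pow, zero_add, add_zero, ← map_add, ← add_mul] at this
    exact this.symm
  have hlin : ∀ u w : Fin r → k, matrixPolar M u w = ∑ i, (∑ j, (M i j + M j i) * u j) * w i := by
    intro u w
    simp only [matrixPolar, mul_add, add_mul, Finset.sum_add_distrib, Finset.sum_mul]
    rw [add_comm]
    nth_rw 2 [Finset.sum_comm]
    congr 1 <;> refine Finset.sum_congr rfl fun i _ => Finset.sum_congr rfl fun j _ => by ring
  have hsymm : ∀ u w : Fin r → k, matrixPolar M u w = matrixPolar M w u := by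
    intro u w
    simp only [matrixPolar]
    refine Finset.sum_congr rfl fun i _ => Finset.sum_congr rfl fun j _ => by ring
  have h3 : ∀ d s, matrixPolar M (fun i => modCoeff p m (d * y i)) (fun i => (y i).coeff s) = 0 := by
    intro d s
    rw [hlin]
    exact coeff_combination_eq_zero hp hm hdeg (fun e => by rw [← hlin]; exact hpol d e) s
  have h4 : ∀ t s, matrixPolar M (fun i => (y i).coeff t) (fun i => (y i).coeff s) = 0 := by
    intro t s
    rw [hlin]
    refine coeff_combination_eq_zero hp hm hdeg (fun e => ?_) s
    rw [← hlin, hsymm]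
    exact h3 e t
  have h5 : 2 * matrixForm (M.map C) y = 0 := by
    have h6 : ∀ i j, 2 * (C (M i j) * y i * y j) = C (M i j) * (y i * y j + y j * y i) :=
      fun i j => by ring
    ext s
    simp only [matrixForm, Finset.mul_sum, h6, Matrix.map_apply, finsetSum_coeff, coeff_C_mul,
      coeff_add, coeff_zero]
    simp only [coeff_mul, ← Finset.sum_add_distrib, Finset.mul_sum]
    rw [Finset.sum_congr rfl fun i _ => Finset.sum_comm, Finset.sum_comm]
    refine Finset.sum_eq_zero fun x _ => ?_
    rw [← h4 x.1 x.2]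
    refine Finset.sum_congr rfl fun i _ => Finset.sum_congr rfl fun j _ => by ring
  have h7 : (2 : k[X]) ≠ 0 := by
    rw [← map_ofNat C 2]
    exact C_ne_zero.mpr h2
  refine hy ?_
  rw [(mul_eq_zero.mp h5).resolve_left h7]
  exact dvd_zero _

/-- Each condition on `c` is open and can be met separately. They are met together by moving along
two lines, each time avoiding finitely many parameters. -/
theorem exists_general_position_scalar {k : Type*} [Field k] [Infinite k] (h2 : (2 : k) ≠ 0)
    {p : k[X]} {m r : ℕ} (hp : p.Monic) (hm : p.natDegree = m + 1) (M : Matrix (Fin r) (Fin r) k)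
    {y : Fin r → k[X]} (hy : IsCoprime p (matrixForm (M.map C) y)) :
    ∃ c, IsCoprime p c ∧ matrixForm M (fun i => modCoeff p m (c * y i)) ≠ 0 ∧
      modCoeff p m (c ^ 2 * matrixForm (M.map C) y) ≠ 0 := by
  have hdvd : ¬ p ∣ matrixForm (M.map C) y := fun h => by
    have := natDegree_eq_zero_of_isUnit (hy.isUnit_of_dvd' dvd_rfl h)
    omega
  have hcop : ∀ c d : k[X], IsCoprime p c → {a : k | ¬ IsCoprime p (c + C a * d)}.Finite := by
    intro c d hc
    have := finite_setOf_not_isCoprime (F₀ := c) (F₁ := d) (F₂ := 0) hp.ne_zero fun β hβ =>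
      ⟨0, by
        simpa using ((isCoprime_iff_aeval_ne_zero_of_isAlgClosed k (AlgebraicClosure k) p c).mp
          hc β).resolve_left (not_not.mpr hβ)⟩
    simpa using this
  have hline : ∀ (c d : k[X]) (a : k), matrixForm M (fun i => modCoeff p m ((c + C a * d) * y i)) =
      matrixForm M (fun i => modCoeff p m (c * y i)) +
        a * matrixPolar M (fun i => modCoeff p m (c * y i)) (fun i => modCoeff p m (d * y i)) +
        a ^ 2 * matrixForm M (fun i => modCoeff p m (d * y i)) := by
    intro c d a
    rw [← matrixForm_add_mul]
    congr 1
    funext i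
    rw [add_mul, map_add, mul_assoc, modCoeff_C_mul]
  obtain ⟨d, hd⟩ := exists_matrixForm_modCoeff_ne_zero h2 hp hm M hdvd
  obtain ⟨e, he⟩ := exists_modCoeff_sq_mul_ne_zero h2 hp hm hdvd
  -- On the line `1 + a d` coprimality holds at `a = 0`, and `d` makes the `a²` coefficient of the
  -- form nonzero.
  obtain ⟨a, ha⟩ := ((hcop 1 d isCoprime_one_right).union
    (finite_setOf_quadratic_eq_zero_of_ne
      (u := matrixForm M (fun i => modCoeff p m (1 * y i)))
      (v := matrixPolar M (fun i => modCoeff p m (1 * y i)) (fun i => modCoeff p m (d * y i)))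
      hd)).infinite_compl.nonempty
  simp only [Set.mem_compl_iff, Set.mem_union, Set.mem_ofPred_eq, not_or, not_not, ← hline] at ha
  set c := 1 + C a * d
  set F := matrixForm (M.map C) y
  -- The first two conditions already hold at `a' = 0`; `e` makes the third a nonzero quadratic.
  obtain ⟨a', ha'⟩ := (((hcop c e ha.1).union
    (finite_setOf_quadratic_eq_zero (a₀ := 0)
      (u := matrixForm M (fun i => modCoeff p m (c * y i)))
      (v := matrixPolar M (fun i => modCoeff p m (c * y i)) (fun i => modCoeff p m (e * y i)))
      (w := matrixForm M (fun i => modCoeff p m (e * y i))) (by simpa using ha.2))).union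
    (finite_setOf_quadratic_eq_zero_of_ne (u := modCoeff p m (c ^ 2 * F))
      (v := modCoeff p m (2 * c * e * F)) he)).infinite_compl.nonempty
  simp only [Set.mem_compl_iff, Set.mem_union, Set.mem_ofPred_eq, not_or, not_not, ← hline] at ha'
  refine ⟨c + C a' * e, ha'.1.1, ha'.1.2, ?_⟩
  convert ha'.2 using 1
  rw [← modCoeff_C_mul, ← modCoeff_C_mul, ← map_add, ← map_add, C_pow]
  congr 1
  ring

/-- Subtracting `p * C (l i)` cancels the new top coefficient of `(X - C a) * y i` when `p` is monic
of degree `m + 1` and `y i` has degree at most `m`, without changing its class modulo `p`. -/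
theorem exists_general_position_linear {k : Type*} [Field k] [Infinite k]
    {p b : k[X]} {m r : ℕ} (hp : p.Monic) (M : Matrix (Fin r) (Fin r) k)
    {y : Fin r → k[X]} {l : Fin r → k} (hl : matrixForm M l ≠ 0) (hy : ∀ i, (y i).coeff m = l i)
    (hb0 : b ≠ 0) (hb : IsCoprime b p) (δ : k) :
    ∃ a : k, p.eval a ≠ 0 ∧
      matrixForm M (fun i => ((X - C a) * y i - p * C (l i)).coeff m) ≠ δ ∧
      IsCoprime b (matrixForm (M.map C) (fun i => (X - C a) * y i - p * C (l i))) := by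
  classical
  have e : ∀ a : k, (fun i => (X - C a) * y i - p * C (l i)) =
      fun i => (X * y i - p * C (l i)) + C a * (-y i) := fun a => by
    funext i; ring
  have e' : ∀ a : k, (fun i => ((X - C a) * y i - p * C (l i)).coeff m) =
      fun i => (X * y i - p * C (l i)).coeff m + a * (- l i) := fun a => by
    funext i
    rw [congrFun (e a) i, coeff_add, coeff_C_mul, coeff_neg, hy]
  have hl' : matrixForm M (fun i => -l i) ≠ 0 := by
    have := matrixForm_mul M (-1) l
    simp only [neg_one_mul] at this
    rw [this]
    simpa using hl
  have f1 : {a : k | p.eval a = 0}.Finite :=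
    p.roots.toFinset.finite_toSet.subset fun a ha => by simpa [hp.ne_zero] using ha
  have f2 := finite_setOf_quadratic_eq_zero_of_ne
    (u := matrixForm M (fun i => (X * y i - p * C (l i)).coeff m) - δ)
    (v := matrixPolar M (fun i => (X * y i - p * C (l i)).coeff m) (fun i => -l i)) hl'
  have f3 := finite_setOf_not_isCoprime hb0
    (F₀ := matrixForm (M.map C) (fun i => X * y i - p * C (l i)))
    (F₁ := matrixPolar (M.map C) (fun i => X * y i - p * C (l i)) (fun i => -y i))
    (F₂ := matrixForm (M.map C) (fun i => -y i)) fun β hβ => by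
      -- For `a₀ = β` the factor `X - a₀` vanishes at `β`, leaving the value `p(β)² Q(l)`, which is
      -- nonzero.
      refine ⟨β, ?_⟩
      have hpβ := ((isCoprime_iff_aeval_ne_zero_of_isAlgClosed k (AlgebraicClosure k) b p).mp
          hb β).resolve_left (not_not.mpr hβ)
      have h1 := matrixForm_add_mul (M.map C) (fun i => X * y i - p * C (l i)) (fun i => -y i) X
      have h2 : (fun i => (X * y i - p * C (l i)) + X * (-y i)) = fun i => -p * C (l i) := by
        funext i; ring
      have h3 : matrixForm (M.map C) (fun i => C (l i)) = C (matrixForm M l) :=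
        (map_matrixForm M C l).symm
      rw [h2, matrixForm_mul, h3] at h1
      have h4 := congrArg (aeval β) h1
      simp only [map_add, map_mul, map_pow, aeval_X, aeval_C, map_neg] at h4
      rw [← h4]
      refine mul_ne_zero (pow_ne_zero _ (neg_ne_zero.mpr hpβ)) ?_
      simpa using hl
  obtain ⟨a, ha⟩ := ((f1.union f2).union f3).infinite_compl.nonempty
  simp only [Set.mem_compl_iff, Set.mem_union, Set.mem_ofPred_eq, not_or, not_not] at ha
  refine ⟨a, ha.1.1, ?_, ?_⟩
  · rw [e', matrixForm_add_mul, ← sub_ne_zero]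
    convert ha.1.2 using 1
    ring
  · rw [e, matrixForm_add_mul]
    exact ha.2

/-! ### Semi-local rings -/

section Semilocal

variable {R : Type*} [CommRing R]

theorem isUnit_iff_forall_residueField_ne_zero {a : R} :
    IsUnit a ↔ ∀ m : MaximalSpectrum R, algebraMap R m.asIdeal.ResidueField a ≠ 0 := by
  refine ⟨fun h m => (h.map _).ne_zero, fun h => by_contra fun ha => ?_⟩
  obtain ⟨m, hm, ham⟩ := exists_max_ideal_of_mem_nonunits ha
  exact h ⟨m, hm⟩ (Ideal.algebraMap_residueField_eq_zero.mpr ham)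

theorem exists_forall_algebraMap_residueField_eq [Finite (MaximalSpectrum R)]
    (x : ∀ m : MaximalSpectrum R, m.asIdeal.ResidueField) :
    ∃ a : R, ∀ m : MaximalSpectrum R, algebraMap R m.asIdeal.ResidueField a = x m := by
  choose y hy using fun m : MaximalSpectrum R => m.asIdeal.algebraMap_residueField_surjective (x m)
  obtain ⟨a, ha⟩ := Ideal.pi_quotient_surjective (I := fun m : MaximalSpectrum R => m.asIdeal)
    (fun m m' h => Ideal.isCoprime_of_isMaximal fun h' => h (MaximalSpectrum.ext h'))
    (fun m => Ideal.Quotient.mk _ (y m))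
  refine ⟨a, fun m => ?_⟩
  rw [← hy, ← sub_eq_zero, ← map_sub, Ideal.algebraMap_residueField_eq_zero]
  exact Ideal.Quotient.eq.mp (ha m)

theorem exists_forall_map_residueField_eq [Finite (MaximalSpectrum R)]
    (f : ∀ m : MaximalSpectrum R, m.asIdeal.ResidueField[X]) :
    ∃ g : R[X], ∀ m : MaximalSpectrum R, g.map (algebraMap R m.asIdeal.ResidueField) = f m := by
  have := Fintype.ofFinite (MaximalSpectrum R)
  choose a ha using fun i => exists_forall_algebraMap_residueField_eq fun m => (f m).coeff i
  refine ⟨∑ i ∈ Finset.range ((Finset.univ.sup fun m => (f m).natDegree) + 1), C (a i) * X ^ i,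
    fun m => ?_⟩
  simp only [Polynomial.map_sum, Polynomial.map_mul, map_C, Polynomial.map_pow, map_X, ha]
  refine (as_sum_range_C_mul_X_pow' _ (Nat.lt_succ_of_le ?_)).symm
  exact Finset.le_sup (f := fun m => (f m).natDegree) (Finset.mem_univ m)

/-- Coprimality with a monic `p` means that the resultant is a unit, and the resultant commutes with
base change. -/
theorem isCoprime_iff_forall_residueField {p f : R[X]} (hp : p.Monic) :
    IsCoprime p f ↔ ∀ m : MaximalSpectrum R, IsCoprime
      (p.map (algebraMap R m.asIdeal.ResidueField)) (f.map (algebraMap R m.asIdeal.ResidueField)) := by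
  rw [← isUnit_resultant_iff_isCoprime hp, isUnit_iff_forall_residueField_ne_zero]
  refine forall_congr' fun m => ?_
  rw [← isUnit_resultant_iff_isCoprime (hp.map _),
    ← (hp.map _).resultant_natDegree_eq natDegree_map_le, hp.natDegree_map, resultant_map_map,
    isUnit_iff_ne_zero]

theorem map_modCoeff {A B : Type*} [CommRing A] [CommRing B] (f : A →+* B) {p : A[X]} (hp : p.Monic)
    (m : ℕ) (g : A[X]) : f (modCoeff p m g) = modCoeff (p.map f) m (g.map f) := by
  rw [modCoeff_apply, modCoeff_apply, ← map_modByMonic _ hp, coeff_map]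

theorem exists_general_position_scalar_of_semilocal [Finite (MaximalSpectrum R)]
    (hinf : ∀ m : MaximalSpectrum R, Infinite m.asIdeal.ResidueField) (h2 : IsUnit (2 : R))
    {p : R[X]} {m r : ℕ} (hp : p.Monic) (hm : p.natDegree = m + 1) (M : Matrix (Fin r) (Fin r) R)
    {y : Fin r → R[X]} (hy : IsCoprime p (matrixForm (M.map C) y)) :
    ∃ c, IsCoprime p c ∧ IsUnit (matrixForm M (fun i => modCoeff p m (c * y i))) ∧
      IsUnit (modCoeff p m (c ^ 2 * matrixForm (M.map C) y)) := by
  choose c hc using fun 𝔪 : MaximalSpectrum R => by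
    have := hinf 𝔪
    exact exists_general_position_scalar (k := 𝔪.asIdeal.ResidueField) (m := m)
      (y := fun i => (y i).map (algebraMap R _))
      (by
        have := isUnit_iff_forall_residueField_ne_zero.mp h2 𝔪
        rwa [map_ofNat] at this)
      (hp.map (algebraMap R _)) (by rw [hp.natDegree_map, hm]) (M.map (algebraMap R _)) (by
        rw [← map_matrixForm_map_C]
        exact (isCoprime_iff_forall_residueField hp).mp hy 𝔪)
  obtain ⟨d, hd⟩ := exists_forall_map_residueField_eq c
  refine ⟨d, ?_, ?_, ?_⟩
  · rw [isCoprime_iff_forall_residueField hp]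
    intro 𝔪
    rw [hd]
    exact (hc 𝔪).1
  · rw [isUnit_iff_forall_residueField_ne_zero]
    intro 𝔪
    rw [map_matrixForm]
    simp only [map_modCoeff _ hp, Polynomial.map_mul, hd]
    exact (hc 𝔪).2.1
  · rw [isUnit_iff_forall_residueField_ne_zero]
    intro 𝔪
    rw [map_modCoeff _ hp, Polynomial.map_mul, Polynomial.map_pow, hd, map_matrixForm_map_C]
    exact (hc 𝔪).2.2

theorem exists_general_position_linear_of_semilocal [Finite (MaximalSpectrum R)]
    (hinf : ∀ m : MaximalSpectrum R, Infinite m.asIdeal.ResidueField)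
    {p b : R[X]} {m r : ℕ} (hp : p.Monic) (hb : b.Monic) (M : Matrix (Fin r) (Fin r) R)
    {y : Fin r → R[X]} (hl : IsUnit (matrixForm M (fun i => (y i).coeff m)))
    (hbp : IsCoprime b p) (δ : R) :
    ∃ a : R, IsUnit (p.eval a) ∧
      IsUnit (matrixForm M (fun i => ((X - C a) * y i - p * C ((y i).coeff m)).coeff m) - δ) ∧
      IsCoprime b (matrixForm (M.map C) (fun i => (X - C a) * y i - p * C ((y i).coeff m))) := by
  choose a ha using fun 𝔪 : MaximalSpectrum R => by
    have := hinf 𝔪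
    exact exists_general_position_linear (k := 𝔪.asIdeal.ResidueField) (m := m)
      (y := fun i => (y i).map (algebraMap R _)) (l := fun i => algebraMap R _ ((y i).coeff m))
      (hp.map (algebraMap R _)) (M.map (algebraMap R _))
      (by
        rw [← map_matrixForm]
        exact isUnit_iff_forall_residueField_ne_zero.mp hl 𝔪)
      (fun i => coeff_map _ _) (hb.map (algebraMap R _)).ne_zero
      ((isCoprime_iff_forall_residueField hb).mp hbp 𝔪) (algebraMap R _ δ)
  obtain ⟨d, hd⟩ := exists_forall_algebraMap_residueField_eq a
  have key : ∀ (𝔪 : MaximalSpectrum R) (i : Fin r),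
      ((X - C d) * y i - p * C ((y i).coeff m)).map (algebraMap R 𝔪.asIdeal.ResidueField) =
        (X - C (a 𝔪)) * (y i).map (algebraMap R _) -
          p.map (algebraMap R _) * C (algebraMap R _ ((y i).coeff m)) := by
    intro 𝔪 i
    simp [hd]
  refine ⟨d, ?_, ?_, ?_⟩
  · rw [isUnit_iff_forall_residueField_ne_zero]
    intro 𝔪
    rw [← eval₂_at_apply, ← eval_map, hd]
    exact (ha 𝔪).1
  · rw [isUnit_iff_forall_residueField_ne_zero]
    intro 𝔪
    rw [map_sub, map_matrixForm, sub_ne_zero]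
    have key' := fun i => (coeff_map (p := (X - C d) * y i - p * C ((y i).coeff m))
      (algebraMap R 𝔪.asIdeal.ResidueField) m).symm.trans (by rw [key 𝔪 i])
    rw [funext key']
    exact (ha 𝔪).2.1
  · rw [isCoprime_iff_forall_residueField hb]
    intro 𝔪
    rw [map_matrixForm_map_C]
    simp only [key]
    exact (ha 𝔪).2.2

end Semilocal

/-! ### The norm principle for polynomials -/

theorem exists_monic_of_isUnit_coeff {A : Type*} [CommRing A] [Nontrivial A] {f : A[X]} {d : ℕ}
    (hf : f.natDegree ≤ d) (hu : IsUnit (f.coeff d)) :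
    ∃ g : A[X], g.Monic ∧ g.natDegree = d ∧ f = C (f.coeff d) * g := by
  obtain ⟨v, hv⟩ := hu.exists_left_inv
  have hc : (C v * f).coeff d = 1 := by rw [coeff_C_mul, hv]
  have hd : (C v * f).natDegree ≤ d := (natDegree_C_mul_le _ _).trans hf
  refine ⟨C v * f, monic_of_natDegree_le_of_coeff_eq_one d hd hc,
    natDegree_eq_of_le_of_coeff_ne_zero hd (by rw [hc]; exact one_ne_zero), ?_⟩
  rw [← mul_assoc, ← C_mul, mul_comm _ v, hv, C_1, one_mul]

theorem exists_eq_monic_mul {A : Type*} [CommRing A] [Nontrivial A] {p G : A[X]} {n k : ℕ}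
    (hp : p.Monic) (hn : p.natDegree = n) (hdvd : p ∣ G) (hG : G.natDegree ≤ n + k)
    (hu : IsUnit (G.coeff (n + k))) :
    ∃ h : A[X], h.Monic ∧ h.natDegree = k ∧ G = p * (C (G.coeff (n + k)) * h) := by
  obtain ⟨q, rfl⟩ := hdvd
  have hq : q.natDegree ≤ k := by
    rcases eq_or_ne q 0 with rfl | hq
    · simp
    · rw [hp.natDegree_mul' hq] at hG
      omega
  have hc : (p * q).coeff (n + k) = q.coeff k := by
    rw [coeff_mul_add_eq_of_natDegree_le hn.le hq, ← hn, hp.coeff_natDegree, one_mul]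
  rw [hc] at hu ⊢
  obtain ⟨h, h1, h2, h3⟩ := exists_monic_of_isUnit_coeff hq hu
  exact ⟨h, h1, h2, by rw [← h3]⟩

section NormPrinciple

variable {R : Type*} [CommRing R] [Nontrivial R] [Finite (MaximalSpectrum R)] {r : ℕ}
  {M : Matrix (Fin r) (Fin r) R}

/-- For `k > 0` take `e = X - a` and `z = e x - p l`, with `l` the vector of top coefficients of
`x`. The degree of `z` stays at most `k + 1`, so dividing `Q(z) - e² β b` by `p` leaves degree `k`,
and `a` is chosen generically. -/
theorem exists_reduction (hinf : ∀ m : MaximalSpectrum R, Infinite m.asIdeal.ResidueField)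
    {p b : R[X]} {k : ℕ} {β : R} {x : Fin r → R[X]} (hp : p.Monic) (hpn : p.natDegree = k + 2)
    (hx : ∀ i, (x i).natDegree ≤ k + 1)
    (hl : IsUnit (matrixForm M (fun i => (x i).coeff (k + 1)))) (hb : b.Monic)
    (hbn : b.natDegree = k + 1) (hβ : IsUnit β) (hdvd : p ∣ matrixForm (M.map C) x - C β * b)
    (hbp : IsCoprime b p) :
    ∃ (e h : R[X]) (η : R) (z : Fin r → R[X]), h.Monic ∧ h.natDegree = k ∧
      η ^ (k + 1) ∈ formUnits M ∧
      matrixForm (M.map C) z = e ^ 2 * (C β * b) + p * (C η * h) ∧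
      IsCoprime b (matrixForm (M.map C) z) ∧ IsCoprime h (matrixForm (M.map C) z) := by
  have hβb : (C β * b).natDegree ≤ k + 1 := (natDegree_C_mul_le _ _).trans hbn.le
  -- For `k = 0` the term `(X - a)² β b` would have degree 3, exceeding 2, so `e = 1` and `h = 1`
  -- are used instead.
  rcases Nat.eq_zero_or_pos k with rfl | hk
  · set F := matrixForm (M.map C) x with hF
    have hc : (F - C β * b).coeff (2 + 0) = matrixForm M (fun i => (x i).coeff (0 + 1)) := by
      rw [← coeff_matrixForm M hx, coeff_sub, coeff_eq_zero_of_natDegree_lt (p := C β * b)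
        (by omega), sub_zero]
    obtain ⟨h, h1, h2, h3⟩ := exists_eq_monic_mul (k := 0) hp hpn hdvd
      ((natDegree_sub_le _ _).trans (max_le (natDegree_matrixForm_le M hx) (by omega)))
      (by rw [zero_add, hc]; exact hl)
    rw [zero_add, hc] at h3
    refine ⟨1, h, _, x, h1, h2, ?_, by rw [← h3]; ring, ?_, ?_⟩
    · rw [zero_add, pow_one]
      exact matrixForm_mem_formUnits hl
    · refine isCoprime_of_dvd_sub (f := F - C β * b) ⟨- C β, by ring⟩ ?_
      rw [h3]
      refine hbp.mul_right ((isCoprime_C_mul_right hl).mpr ?_)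
      rw [eq_one_of_monic_natDegree_zero h1 h2]
      exact isCoprime_one_right
    · rw [eq_one_of_monic_natDegree_zero h1 h2]
      exact isCoprime_one_left
  -- `(X - a)² β b` has degree `k + 3`, so for `k > 0` it reaches the top degree `2k + 2` only when
  -- `k = 1`, where it contributes `β`.
  set δ : R := if k = 1 then β else 0 with hδ
  obtain ⟨a, ha, hη, hcop⟩ := exists_general_position_linear_of_semilocal hinf hp hb M hl hbp δ
  obtain ⟨z, hz⟩ : ∃ z : Fin r → R[X], z = fun i => (X - C a) * x i - p * C ((x i).coeff (k + 1)) :=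
    ⟨_, rfl⟩
  have hzi : ∀ i, z i = (X - C a) * x i - p * C ((x i).coeff (k + 1)) := fun i => by rw [hz]
  simp only [← hzi] at hη hcop
  have hzdeg : ∀ i, (z i).natDegree ≤ k + 1 := by
    intro i
    have h1 : (z i).natDegree ≤ k + 2 := by
      rw [hzi]
      refine (natDegree_sub_le _ _).trans (max_le ?_ ?_)
      · refine natDegree_mul_le.trans ?_
        rw [natDegree_X_sub_C]
        have := hx i
        omega
      · exact (natDegree_mul_C_le _ _).trans hpn.le
    have h2 : (z i).coeff (k + 2) = 0 := by
      rw [hzi, coeff_sub, coeff_mul_C, ← hpn, hp.coeff_natDegree, hpn, one_mul,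
        show k + 2 = 1 + (k + 1) by ring, coeff_mul_add_eq_of_natDegree_le
        (natDegree_X_sub_C a).le (hx i)]
      simp
    by_contra hlt
    have h3 : (z i).natDegree = k + 2 := by omega
    rw [← h3, coeff_natDegree, leadingCoeff_eq_zero] at h2
    rw [h2] at h3
    simp at h3
  set F := matrixForm (M.map C) z with hF
  have hsq : ((X - C a) ^ 2).natDegree = 2 := by
    rw [(monic_X_sub_C a).natDegree_pow, natDegree_X_sub_C]
  have hG : (F - (X - C a) ^ 2 * (C β * b)).natDegree ≤ (k + 2) + k := by
    refine (natDegree_sub_le _ _).trans (max_le ?_ ?_)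
    · exact (natDegree_matrixForm_le M hzdeg).trans (by omega)
    · refine natDegree_mul_le.trans ?_
      omega
  have hGc : (F - (X - C a) ^ 2 * (C β * b)).coeff ((k + 2) + k) =
      matrixForm M (fun i => (z i).coeff (k + 1)) - δ := by
    rw [coeff_sub, show k + 2 + k = (k + 1) + (k + 1) by ring, coeff_matrixForm M hzdeg]
    congr 1
    rw [hδ]
    split_ifs with hk1
    · subst hk1
      rw [show 1 + 1 + (1 + 1) = 2 + (1 + 1) by rfl, coeff_mul_add_eq_of_natDegree_le hsq.le hβb,
        coeff_C_mul]
      have h1 := ((monic_X_sub_C a).pow 2).coeff_natDegree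
      have h2 := hb.coeff_natDegree
      rw [hsq] at h1
      rw [hbn] at h2
      rw [h1, h2, one_mul, mul_one]
    · refine coeff_eq_zero_of_natDegree_lt (natDegree_mul_le.trans_lt ?_)
      omega
  have hGdvd : p ∣ F - (X - C a) ^ 2 * (C β * b) := by
    have h1 : p ∣ F - (X - C a) ^ 2 * matrixForm (M.map C) x := by
      rw [← matrixForm_mul]
      refine dvd_matrixForm_sub _ fun i => ⟨- C ((x i).coeff (k + 1)), ?_⟩
      rw [hzi]
      ring
    have h2 := h1.add (hdvd.mul_left ((X - C a) ^ 2))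
    convert h2 using 1
    ring
  obtain ⟨h, h1, h2, h3⟩ := exists_eq_monic_mul hp hpn hGdvd hG (by rw [hGc]; exact hη)
  rw [hGc] at h3
  obtain ⟨η, hη'⟩ : ∃ η, η = matrixForm M (fun i => (z i).coeff (k + 1)) - δ := ⟨_, rfl⟩
  rw [← hη'] at h3 hη
  have hbh : IsCoprime b h := by
    have h4 : IsCoprime b (p * (C η * h)) :=
      isCoprime_of_dvd_sub ⟨(X - C a) ^ 2 * C β, by rw [← h3]; ring⟩ hcop
    exact (isCoprime_C_mul_right hη).mp h4.of_mul_right_right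
  -- At `X = a` the vector `z` is `-p(a) l`, so `F(a) = p(a)² Q(l)` is a unit, and `h(a)` divides
  -- it.
  have hah : IsCoprime (X - C a) h := by
    rw [isCoprime_X_sub_C_iff]
    have h4 : F.eval a = p.eval a * (η * h.eval a) := by
      have := congrArg (eval a) h3
      simpa using this
    have h5 : F.eval a = p.eval a ^ 2 * matrixForm M (fun i => (x i).coeff (k + 1)) := by
      rw [hF, eval_matrixForm_map_C, ← neg_sq, ← matrixForm_mul]
      congr 1
      funext i
      simp [hzi]
    have h6 : IsUnit (F.eval a) := by rw [h5]; exact (ha.pow 2).mul hl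
    rw [h4] at h6
    exact isUnit_of_mul_isUnit_right (isUnit_of_mul_isUnit_right h6)
  refine ⟨X - C a, h, η, z, h1, h2, ?_, ?_, hcop, ?_⟩
  · by_cases hk1 : k = 1
    · subst hk1
      exact sq_mem_formUnits hl hη
    · refine pow_mem ?_ _
      rw [hδ, if_neg hk1, sub_zero] at hη'
      rw [hη'] at hη ⊢
      exact matrixForm_mem_formUnits hη
  · rw [← h3]; ring
  · refine isCoprime_of_dvd_sub (f := (X - C a) ^ 2 * (C β * b)) ⟨- (p * C η), ?_⟩ ?_
    · rw [← sub_eq_zero, mul_neg, sub_neg_eq_add, mul_left_comm, ← mul_assoc, mul_assoc, mul_comm h]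
      linear_combination -h3
    · exact (hah.symm.pow_right).mul_right ((isCoprime_C_mul_right hβ).mpr hbh.symm)

theorem resultant_matrixForm_mem_formUnits
    (hinf : ∀ m : MaximalSpectrum R, Infinite m.asIdeal.ResidueField) (h2 : IsUnit (2 : R))
    {p : R[X]} (hp : p.Monic) {y : Fin r → R[X]} (hy : IsCoprime p (matrixForm (M.map C) y)) :
    resultant p (matrixForm (M.map C) y) ∈ formUnits M := by
  induction hn : p.natDegree using Nat.strong_induction_on generalizing p y with
  | _ n ih =>
  subst hn
  rcases hpn : p.natDegree with _ | _ | k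
  · obtain rfl := eq_one_of_monic_natDegree_zero hp hpn
    simp
  · obtain ⟨a, rfl⟩ : ∃ a, p = X - C a := ⟨-p.coeff 0, by
      rw [C_neg, sub_neg_eq_add]; exact hp.eq_X_add_C hpn⟩
    have hu := isCoprime_X_sub_C_iff.mp hy
    rw [zero_add, resultant_X_sub_C_left _ _ _ le_rfl]
    rw [eval_matrixForm_map_C] at hu ⊢
    exact matrixForm_mem_formUnits hu
  obtain ⟨c, hc, hl, hβ⟩ := exists_general_position_scalar_of_semilocal hinf h2 hp hpn M hy
  set x : Fin r → R[X] := fun i => (c * y i) %ₘ p with hx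
  have hp1 : p ≠ 1 := by rintro rfl; simp at hpn
  have hxdeg : ∀ i, (x i).natDegree ≤ k + 1 := fun i => by
    have := natDegree_modByMonic_lt (c * y i) hp hp1
    rw [hpn] at this
    exact Nat.lt_succ_iff.mp this
  have hxy : p ∣ matrixForm (M.map C) x - c ^ 2 * matrixForm (M.map C) y := by
    rw [← matrixForm_mul]
    exact dvd_matrixForm_sub _ fun i => dvd_modByMonic_sub _ _
  have hbdeg : (matrixForm (M.map C) x %ₘ p).natDegree ≤ k + 1 := by
    have := natDegree_modByMonic_lt (matrixForm (M.map C) x) hp hp1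
    rw [hpn] at this
    exact Nat.lt_succ_iff.mp this
  rw [← modCoeff_congr hp _ hxy, modCoeff_apply] at hβ
  obtain ⟨b, hb, hbn, hbx⟩ := exists_monic_of_isUnit_coeff hbdeg hβ
  set β := (matrixForm (M.map C) x %ₘ p).coeff (k + 1)
  have hxb : p ∣ matrixForm (M.map C) x - C β * b := by
    rw [← hbx, dvd_sub_comm]
    exact dvd_modByMonic_sub _ _
  have hcy : IsCoprime p (c ^ 2 * matrixForm (M.map C) y) := hc.pow_right.mul_right hy
  have hpb : IsCoprime p b := (isCoprime_C_mul_right hβ).mp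
    (isCoprime_of_dvd_sub (by have := hxb.sub hxy; convert! this using 1; ring) hcy)
  obtain ⟨e, h, η, z, hh, hhn, hη, hz, hbz, hhz⟩ :=
    exists_reduction hinf hp hpn hxdeg hl hb hbn hβ hxb hpb.symm
  have hhe : IsUnit (resultant h e) := by
    rw [isUnit_resultant_iff_isCoprime hh]
    have h3 : IsCoprime h (e ^ 2 * (C β * b)) :=
      isCoprime_of_dvd_sub ⟨p * C η, by rw [hz]; ring⟩ hhz
    rw [sq, mul_assoc] at h3
    exact h3.of_mul_right_left
  have hsq : ∀ {a : R}, IsUnit a → a ^ 2 ∈ formUnits M := fun ha => sq_mem_formUnits hl ha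
  -- The induction hypothesis applies to `b` and `h`, of degrees `k + 1` and `k`, with the same
  -- vector `z`.
  have hmem : resultant p (C β * b) ∈ formUnits M := by
    refine mem_formUnits_of_mul_mem hη (mem_formUnits_of_mul_mem
      (ih _ (by omega) hh hhz rfl) ?_)
    rw [resultant_reduction hp hb hh hpn hbn hhn hz]
    exact mul_mem (hsq ((hβ.pow _).mul hhe)) (ih _ (by omega) hb hbz rfl)
  refine mem_formUnits_of_mul_mem (hsq ((isUnit_resultant_iff_isCoprime hp).mpr hc)) ?_
  rw [← hp.resultant_eq_of_dvd_sub hxb, hp.resultant_eq_of_dvd_sub hxy, hp.resultant_mul, sq,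
    hp.resultant_mul] at hmem
  rw [hpn] at hmem ⊢
  convert hmem using 1
  ring

end NormPrinciple

/-! ### Norms as resultants -/

/-- Both sides are multiplicative in `g`, so constants and linear factors suffice; for `X - a` both
give the characteristic polynomial at `a` up to the same sign. -/
theorem Matrix.det_aeval_eq_resultant_of_isAlgClosed {K n : Type*} [Field K] [IsAlgClosed K]
    [Fintype n] [DecidableEq n] (A : Matrix n n K) (g : K[X]) :
    (aeval A g).det = resultant A.charpoly g := by
  have hmul : ∀ f g : K[X], (aeval A f).det = resultant A.charpoly f →
      (aeval A g).det = resultant A.charpoly g →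
      (aeval A (f * g)).det = resultant A.charpoly (f * g) := fun f g hf hg => by
    rw [map_mul, Matrix.det_mul, A.charpoly_monic.resultant_mul, hf, hg]
  have hC : ∀ a : K, (aeval A (C a)).det = resultant A.charpoly (C a) := fun a => by
    rw [aeval_C, natDegree_C, resultant_C_zero_right, Matrix.charpoly_natDegree_eq_dim,
      Algebra.algebraMap_eq_smul_one, Matrix.det_smul, Matrix.det_one, mul_one]
  have hX : ∀ a : K, (aeval A (X - C a)).det = resultant A.charpoly (X - C a) := fun a => by
    rw [natDegree_X_sub_C, resultant_X_sub_C_right _ _ _ le_rfl, Matrix.eval_charpoly,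
      Matrix.charpoly_natDegree_eq_dim, ← Matrix.det_neg, neg_sub, map_sub, aeval_X, aeval_C]
    rfl
  rw [(IsAlgClosed.splits g).eq_prod_roots]
  refine hmul _ _ (hC _) ?_
  induction g.roots using Multiset.induction with
  | empty => simp
  | cons a s ih =>
    rw [Multiset.map_cons, Multiset.prod_cons]
    exact hmul _ _ (hX a) ih

theorem Matrix.det_aeval_eq_resultant {R n : Type*} [CommRing R] [IsDomain R] [Fintype n]
    [DecidableEq n] (A : Matrix n n R) (g : R[X]) :
    (aeval A g).det = resultant A.charpoly g := by
  let K := AlgebraicClosure (FractionRing R)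
  let f : R →+* K := (algebraMap (FractionRing R) K).comp (algebraMap R (FractionRing R))
  have hf : Function.Injective f :=
    (algebraMap (FractionRing R) K).injective.comp (IsFractionRing.injective R (FractionRing R))
  apply hf
  have h1 := Matrix.det_aeval_eq_resultant_of_isAlgClosed (A.map f) (g.map f)
  have h2 : f.mapMatrix (aeval A g) = aeval (f.mapMatrix A) (g.map f) :=
    map_aeval_eq_aeval_map (by ext; simp [Matrix.algebraMap_matrix_apply, apply_ite f]) _ _
  rw [RingHom.map_det, h2, RingHom.mapMatrix_apply, h1, Matrix.charpoly_map, ← resultant_map_map,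
    A.charpoly_monic.natDegree_map, natDegree_map_eq_of_injective hf]

theorem PowerBasis.norm_aeval_gen {R S : Type*} [CommRing R] [IsDomain R] [CommRing S] [Algebra R S]
    (b : PowerBasis R S) (g : R[X]) :
    Algebra.norm R (aeval b.gen g) = resultant (minpoly R b.gen) g := by
  rw [Algebra.norm_eq_matrix_det b.basis, ← aeval_algHom_apply, Matrix.det_aeval_eq_resultant,
    charpoly_leftMulMatrix]

/-! ### Primitive elements of étale algebras -/

/-- The algebra is a product of finite separable extensions. Translating their primitive elements by
scalars makes the minimal polynomials distinct, hence pairwise coprime, and the Chinese remainder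
theorem applies. -/
theorem Algebra.Etale.exists_aeval_surjective (k A : Type*) [Field k] [Infinite k] [CommRing A]
    [Algebra k A] [Algebra.Etale k A] : ∃ α : A, Function.Surjective (aeval (R := k) α) := by
  classical
  obtain ⟨I, hI, L, _, _, e, hL⟩ := (Algebra.Etale.iff_exists_algEquiv_prod k A).mp inferInstance
  have := Fintype.ofFinite I
  have hfin := fun i => (hL i).1
  have hsep := fun i => (hL i).2
  choose α hα using fun i => Field.exists_primitive_element k (L i)
  have hint : ∀ i (x : L i), IsIntegral k x := fun i x => Algebra.IsIntegral.isIntegral x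
  -- A given minimal polynomial has finitely many roots, so it arises from finitely many
  -- translations.
  have hinf : ∀ i, (Set.range fun c : k => minpoly k (α i + algebraMap k (L i) c)).Infinite := by
    intro i hfin
    refine Set.infinite_univ ((hfin.preimage' fun f hf => ?_).subset fun c _ => Set.mem_range_self c)
    obtain ⟨c₀, rfl⟩ := hf
    have h0 := minpoly.ne_zero (hint i (α i + algebraMap k (L i) c₀))
    refine Set.Finite.subset (Set.Finite.preimage
      (((add_right_injective (α i)).comp (algebraMap k (L i)).injective).injOn)
      ((minpoly k (α i + algebraMap k (L i) c₀)).aroots (L i)).toFinset.finite_toSet) fun c hc => ?_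
    rw [Set.mem_preimage, Finset.mem_coe, Multiset.mem_toFinset, mem_aroots]
    refine ⟨h0, ?_⟩
    have hc' : minpoly k (α i + algebraMap k (L i) c) =
      minpoly k (α i + algebraMap k (L i) c₀) := hc
    rw [← hc']
    exact minpoly.aeval _ _
  choose t ht htc using fun i => (hinf i).exists_subset_card_eq (Fintype.card I)
  -- Hall's condition is immediate: each factor offers as many candidates as there are factors.
  obtain ⟨f, hf, hft⟩ := (Finset.all_card_le_biUnion_card_iff_exists_injective t).mp fun s => by
    rcases s.eq_empty_or_nonempty with rfl | ⟨i, hi⟩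
    · simp
    · exact s.card_le_univ.trans ((htc i).symm.le.trans
        (Finset.card_le_card (Finset.subset_biUnion_of_mem t hi)))
  choose c hc using fun i => ht i (hft i)
  set β : ∀ i, L i := fun i => α i + algebraMap k (L i) (c i)
  have hf' : ∀ i, f i = minpoly k (β i) := fun i => (hc i).symm
  have hβ : ∀ i, Function.Surjective (aeval (R := k) (β i)) := by
    intro i x
    have hx : x ∈ (aeval (R := k) (α i)).range := by
      rw [← Algebra.adjoin_singleton_eq_range_aeval,
        ← IntermediateField.adjoin_simple_toSubalgebra_of_isAlgebraic (hint i _).isAlgebraic, hα]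
      trivial
    obtain ⟨g, rfl⟩ := hx
    refine ⟨g.comp (X - C (c i)), ?_⟩
    rw [aeval_comp]
    simp [β]
  refine ⟨e.symm β, ?_⟩
  have hcop : Pairwise (Function.onFun IsCoprime fun i => Ideal.span {f i}) := by
    intro i j hij
    rw [Function.onFun, Ideal.isCoprime_span_singleton_iff]
    rw [hf', hf']
    refine ((minpoly.irreducible (hint i (β i))).coprime_iff_not_dvd).mpr fun h => hij (hf ?_)
    rw [hf', hf']
    exact eq_of_monic_of_associated (minpoly.monic (hint i _)) (minpoly.monic (hint j _))
      ((minpoly.irreducible (hint i _)).associated_of_dvd (minpoly.irreducible (hint j _)) h)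
  intro a
  choose g hg using fun i => hβ i (e a i)
  obtain ⟨G, hG⟩ := Ideal.pi_quotient_surjective hcop fun i => Ideal.Quotient.mk _ (g i)
  refine ⟨G, e.injective ?_⟩
  rw [aeval_algHom_apply, AlgEquiv.apply_symm_apply]
  funext i
  have h1 : (aeval β G) i = aeval (β i) G := (aeval_algHom_apply (Pi.evalAlgHom k L i) β G).symm
  rw [h1, ← hg, ← sub_eq_zero, ← map_sub]
  obtain ⟨q, hq⟩ := Ideal.mem_span_singleton.mp (Ideal.Quotient.eq.mp (hG i))
  rw [hq, hf', map_mul, minpoly.aeval, zero_mul]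

open TensorProduct

/-- A finite étale algebra over a semi-local domain with infinite residue fields has a power
basis. -/
theorem Algebra.Etale.exists_powerBasis (R S : Type*) [CommRing R] [IsDomain R] [IsNoetherianRing R]
    [Finite (MaximalSpectrum R)]
    (hinf : ∀ m : MaximalSpectrum R, Infinite m.asIdeal.ResidueField)
    [CommRing S] [Algebra R S] [Module.Finite R S] [Algebra.Etale R S] :
    Nonempty (PowerBasis R S) := by
  classical
  have := Fintype.ofFinite (MaximalSpectrum R)
  choose α₀ hα₀ using fun m : MaximalSpectrum R => by
    have := hinf m
    exact Algebra.Etale.exists_aeval_surjective m.asIdeal.ResidueField (m.asIdeal.Fiber S)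
  have hone : ∀ (m : MaximalSpectrum R) (x : m.asIdeal.Fiber S), ∃ s : S, 1 ⊗ₜ s = x := by
    intro m x
    induction x using TensorProduct.induction_on with
    | zero => exact ⟨0, tmul_zero _ _⟩
    | add x y hx hy =>
      obtain ⟨s, rfl⟩ := hx
      obtain ⟨t, rfl⟩ := hy
      exact ⟨s + t, tmul_add _ _ _⟩
    | tmul a s =>
      obtain ⟨a, rfl⟩ := m.asIdeal.algebraMap_residueField_surjective a
      exact ⟨a • s, by rw [tmul_smul, smul_tmul', Algebra.algebraMap_eq_smul_one]⟩
  choose s hs using fun m => hone m (α₀ m)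
  choose c hc using fun m : MaximalSpectrum R => exists_forall_algebraMap_residueField_eq
    (R := R) (fun m' => if m' = m then 1 else 0)
  -- Each `c m` is 1 at `m` and 0 at the other maximal ideals, so `α` lifts all the chosen
  -- generators at once.
  set α : S := ∑ m, c m • s m
  have hα : ∀ m : MaximalSpectrum R, (1 : m.asIdeal.ResidueField) ⊗ₜ[R] α = α₀ m := by
    intro m
    simp only [α, tmul_sum, tmul_smul]
    rw [Finset.sum_eq_single m]
    · rw [smul_tmul', ← Algebra.algebraMap_eq_smul_one, hc, if_pos rfl, hs]
    · intro m' _ hm'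
      rw [smul_tmul', ← Algebra.algebraMap_eq_smul_one, hc, if_neg hm'.symm, zero_tmul]
    · simp
  set n := Module.finrank R S with hn
  let φ : (Fin n → R) →ₗ[R] S := Fintype.linearCombination R fun i : Fin n => α ^ (i : ℕ)
  -- By Cayley–Hamilton, division by the characteristic polynomial of `α₀ m` leaves only powers
  -- below `n`, the rank of every fiber.
  have hspan : ∀ (m : MaximalSpectrum R) (x : m.asIdeal.Fiber S),
      ∃ v : Fin n → R, 1 ⊗ₜ φ v = x := by
    intro m x
    obtain ⟨g, rfl⟩ := hα₀ m x
    have hfr : Module.finrank m.asIdeal.ResidueField (m.asIdeal.Fiber S) = n :=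
      Ideal.finrank_fiber_eq_finrank _
    set q := (Algebra.lmul m.asIdeal.ResidueField (m.asIdeal.Fiber S) (α₀ m)).charpoly
    have hq : q.Monic := LinearMap.charpoly_monic _
    have hqn : q.natDegree = n := by rw [LinearMap.charpoly_natDegree, hfr]
    have hg : aeval (α₀ m) g = aeval (α₀ m) (g %ₘ q) := by
      nth_rw 1 [← modByMonic_add_div g q]
      rw [map_add, map_mul, Algebra.aeval_self_charpoly_lmul, zero_mul, add_zero]
    have hdeg : (g %ₘ q).degree < n := by
      rw [← hqn, ← degree_eq_natDegree hq.ne_zero]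
      exact degree_modByMonic_lt _ hq
    choose v hv using fun i : Fin n =>
      m.asIdeal.algebraMap_residueField_surjective ((g %ₘ q).coeff i)
    refine ⟨v, ?_⟩
    rw [hg, aeval_def, eval₂_eq_sum, ← sum_fin _ (by simp) hdeg, Fintype.linearCombination_apply,
      tmul_sum]
    refine Finset.sum_congr rfl fun i _ => ?_
    rw [tmul_smul, smul_tmul', ← Algebra.algebraMap_eq_smul_one, hv, ← hα,
      Algebra.TensorProduct.tmul_pow, one_pow, ← Algebra.smul_def, smul_tmul', smul_eq_mul, mul_one]
  -- Nakayama: the cokernel vanishes in every closed fiber, so its support is empty.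
  have hsurj : Function.Surjective φ := by
    rw [← LinearMap.range_eq_top, ← Submodule.Quotient.subsingleton_iff,
      ← Module.support_eq_empty_iff (R := R), Set.eq_empty_iff_forall_notMem]
    intro p hp
    obtain ⟨m, hm, hpm⟩ := Ideal.exists_le_maximal p.asIdeal p.2.ne_top
    have h1 := Module.mem_support_mono (q := ⟨m, hm.isPrime⟩) hpm hp
    rw [Module.mem_support_iff_nontrivial_residueField_tensorProduct] at h1
    refine not_subsingleton_iff_nontrivial.mpr h1 ⟨fun x y => ?_⟩
    have hzero : ∀ x : m.ResidueField ⊗[R] (S ⧸ LinearMap.range φ), x = 0 := by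
      intro x
      obtain ⟨z, rfl⟩ := LinearMap.lTensor_surjective m.ResidueField
        (Submodule.mkQ_surjective (LinearMap.range φ)) x
      obtain ⟨v, rfl⟩ := hspan ⟨m, hm⟩ z
      rw [LinearMap.lTensor_tmul, Submodule.mkQ_apply,
        (Submodule.Quotient.mk_eq_zero _).mpr (LinearMap.mem_range_self φ v), tmul_zero]
    exact (hzero x).trans (hzero y).symm
  -- Source and target both have rank `n`, so the kernel has rank zero inside a free module over a
  -- domain.
  have hinj : LinearMap.ker φ = ⊥ := by
    rw [← Submodule.finrank_eq_zero (R := R)]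
    have h1 := Submodule.finrank_quotient_add_finrank (LinearMap.ker φ)
    rw [(φ.quotKerEquivOfSurjective hsurj).finrank_eq, Module.finrank_fin_fun] at h1
    omega
  let b : Module.Basis (Fin n) R S := Module.Basis.ofEquivFun
    (LinearEquiv.ofBijective φ ⟨LinearMap.ker_eq_bot.mp hinj, hsurj⟩).symm
  refine ⟨⟨α, n, b, fun i => ?_⟩⟩
  rw [Module.Basis.coe_ofEquivFun, LinearEquiv.symm_symm]
  change φ (Pi.single i 1) = _
  simp [φ, Fintype.linearCombination_apply, Pi.single_apply]

/-! ### The norm principle -/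

section

variable {R V : Type*} [CommRing R] [Invertible (2 : R)] [AddCommGroup V] [Module R V]

/-- The Gram matrix of a family of vectors. -/
def gramMatrix (q : QuadraticForm R V) {r : ℕ} (v : Fin r → V) : Matrix (Fin r) (Fin r) R :=
  Matrix.of fun i j => QuadraticMap.associated (R := R) q (v i) (v j)

/-- The vectors `v i` are those of any tensor expression, not a basis; this puts a value of the base
change in the form that the polynomial argument handles. -/
theorem baseChange_sum_tmul (q : QuadraticForm R V) {S : Type*} [CommRing S] [Algebra R S] {r : ℕ}
    (v : Fin r → V) (s : Fin r → S) :
    q.baseChange S (∑ i, s i ⊗ₜ v i) = matrixForm ((gramMatrix q v).map (algebraMap R S)) s := by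
  let : Invertible (2 : S) := (Invertible.map (algebraMap R S) 2).copy 2 (map_ofNat _ _).symm
  rw [← QuadraticMap.associated_eq_self_apply S (q.baseChange S), QuadraticForm.associated_baseChange]
  simp only [map_sum, LinearMap.sum_apply, LinearMap.BilinForm.baseChange_tmul, matrixForm,
    gramMatrix, Matrix.map_apply, Matrix.of_apply, Algebra.smul_def]
  rw [Finset.sum_comm]
  refine Finset.sum_congr rfl fun i _ => Finset.sum_congr rfl fun j _ => ?_
  ring

theorem matrixForm_gramMatrix (q : QuadraticForm R V) {r : ℕ} (v : Fin r → V) (c : Fin r → R) :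
    matrixForm (gramMatrix q v) c = q (∑ i, c i • v i) := by
  rw [← QuadraticMap.associated_eq_self_apply R q]
  simp only [map_sum, LinearMap.sum_apply, map_smul, LinearMap.smul_apply, smul_eq_mul, matrixForm,
    gramMatrix, Matrix.of_apply, Finset.mul_sum, QuadraticMap.coe_associatedHom]
  rw [Finset.sum_comm]
  refine Finset.sum_congr rfl fun i _ => Finset.sum_congr rfl fun j _ => ?_
  ring

theorem exists_mem_representedUnits_of_mem_formUnits (q : QuadraticForm R V) {r : ℕ}
    (v : Fin r → V) {u : Rˣ} (h : (u : R) ∈ formUnits (gramMatrix q v)) :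
    u ∈ representedUnits q := by
  obtain ⟨w, hw, hwu⟩ := h
  obtain rfl : w = u := Units.ext hwu
  refine Subgroup.closure_mono ?_ hw
  rintro w ⟨c, hc⟩
  exact ⟨∑ i, c i • v i, by rw [← matrixForm_gramMatrix, hc]⟩

theorem map_norm_representedUnits_le [IsDomain R] [IsNoetherianRing R] [Finite (MaximalSpectrum R)]
    (hinf : ∀ m : MaximalSpectrum R, Infinite m.asIdeal.ResidueField)
    {S : Type*} [CommRing S] [Algebra R S] [Module.Finite R S] [Algebra.Etale R S]
    (q : QuadraticForm R V) :
    (representedUnits (q.baseChange S)).map (Units.map (Algebra.norm R : S →* R)) ≤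
      representedUnits q := by
  rw [Subgroup.map_le_iff_le_comap, representedUnits, Subgroup.closure_le]
  rintro u ⟨x, hx⟩
  obtain ⟨r, s, v, rfl⟩ := TensorProduct.exists_sum_tmul_eq x
  obtain ⟨b⟩ := Algebra.Etale.exists_powerBasis R S hinf
  rw [baseChange_sum_tmul] at hx
  choose y hy using fun i => b.exists_eq_aeval' (s i)
  have hu : (u : S) = aeval b.gen (matrixForm ((gramMatrix q v).map C) y) := by
    have := map_matrixForm ((gramMatrix q v).map C) (aeval (R := R) b.gen : R[X] →+* S) y
    rw [← hx, ← AlgHom.coe_toRingHom, this]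
    congr 1
    · ext i j
      simp
    · funext i
      exact hy i
  have hp : (minpoly R b.gen).Monic := minpoly.monic b.isIntegral_gen
  have hnorm : ((Units.map (Algebra.norm R : S →* R) u : Rˣ) : R) =
      resultant (minpoly R b.gen) (matrixForm ((gramMatrix q v).map C) y) := by
    rw [Units.coe_map, ← b.norm_aeval_gen, ← hu]
  refine exists_mem_representedUnits_of_mem_formUnits q v ?_
  rw [hnorm]
  refine resultant_matrixForm_mem_formUnits hinf (isUnit_of_invertible 2) hp ?_
  -- Coprimality with the minimal polynomial amounts to the norm being a unit, which holds because
  -- `u` is one.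
  rw [← isUnit_resultant_iff_isCoprime hp, ← hnorm]
  exact Units.isUnit _

end

theorem mainTheorem1 {R S V : Type*} [CommRing R] [IsDomain R] [IsNoetherianRing R]
    [Finite (MaximalSpectrum R)]
    (hinf : ∀ m : Ideal R, m.IsMaximal → Infinite (R ⧸ m))
    (hchar : ∀ m : Ideal R, m.IsMaximal → ringChar (R ⧸ m) ≠ 2)
    [CommRing S] [Algebra R S] [Module.Finite R S] [Algebra.Etale R S]
    [AddCommGroup V] [Module R V] (q : QuadraticForm R V) (hq : IsQuadraticSpace q) :
    letI : Invertible (2 : R) := invertibleTwoOfResidue hchar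
    (representedUnits (q.baseChange S)).map (Units.map (Algebra.norm R : S →* R)) ≤
      representedUnits q := by
  let : Invertible (2 : R) := invertibleTwoOfResidue hchar
  refine map_norm_representedUnits_le (fun m => ?_) q
  have := hinf m.asIdeal m.isMaximal
  exact Infinite.of_injective _ m.asIdeal.injective_algebraMap_quotient_residueField
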